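/- **Depth Kirchberger's theorem.** For a finite set $X\subset\mathbb R^d$ and $q\in\mathbb R^d$, let the Tukey depth $\tau_X(q)\in[0,1]$ be the minimum of $|X\cap H|/|X|$ over all closed half-spaces $H$ that contain $q$. Say that two sets are separated by a hyperplane if they lie in the two opposite open half-spaces bounded by it. There exist constants $c(d,\tau)$, depending only on the integer $d\ge 1$ and the real number $\tau\ge 0$, with $c(d,\tau)>0$ for $\tau>0$ and $c(d,0)=0$, such that the following two statements hold. 1. (These are constants for the Depth Carathéodory theorem.) Let $d\ge 1$, let $X\subset\mathbb R^d$ be a finite set of at least $d+1$ points, and let $q\in\mathbb R^d$ have positive Tukey depth $\tau_X(q)$. Then there are pairwise disjoint subsets $X_1,\dots,X_{d+1}$ of $X$, each with at least $c(d,\tau_X(q))\,|X|$ points, such that $q\in\operatorname{Conv}(\{x_1,\dots,x_{d+1}\})$ for every choice of points $x_i\in X_i$. 2. Let $d\ge 2$, $0\le\beta\le 1$ and $\alpha=c(d,1-\beta)$. Let $R$ and $B$ be sets of points in $\mathbb R^d$ such that $R\cup B$ has $n$ points, where $n$ is finite. Suppose that for every choice of non-empty subsets $Y_1,\dots,Y_{d+2}$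 of $R\cup B$, each with at least $\alpha n$ points, there are $y_i\in Y_i$ such that, with $S=\{y_1,\dots,y_{d+2}\}$, the set $S\cap R$ can be separated by a hyperplane from $S\cap B$. Then there exist subsets $R'\subseteq R$ and $B'\subseteq B$ such that $|R'\cup B'|\ge\beta n$ and $R'$ can be separated from $B'$ by a hyperplane. -/

import Mathlib

/-- The closed half-space `{x | b ≤ ⟪a, x⟫}` of `ℝ^d` (a half-space when `a ≠ 0`). -/
def closedHalfspace {d : ℕ} (a : EuclideanSpace ℝ (Fin d)) (b : ℝ) :
    Set (EuclideanSpace ℝ (Fin d)) :=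
  {x | b ≤ inner ℝ a x}

/-- The unnormalised Tukey depth of `q` with respect to the finite point set `X`: the least number
of points of `X` in a closed half-space that contains `q`. -/
noncomputable def tukeyCount {d : ℕ} (X : Set (EuclideanSpace ℝ (Fin d)))
    (q : EuclideanSpace ℝ (Fin d)) : ℕ :=
  sInf {k : ℕ | ∃ a : EuclideanSpace ℝ (Fin d), ∃ b : ℝ, a ≠ 0 ∧ q ∈ closedHalfspace a b ∧
    k = (X ∩ closedHalfspace a b).ncard}

/-- The Tukey depth `τ_X(q)`, normalised by the number of points of `X`. -/
noncomputable def tukeyDepth {d : ℕ} (X : Set (EuclideanSpace ℝ (Fin d)))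
    (q : EuclideanSpace ℝ (Fin d)) : ℝ :=
  (tukeyCount X q : ℝ) / (X.ncard : ℝ)

/-- `A` and `B` lie in the two opposite open half-spaces bounded by some hyperplane
`{x | ⟪a, x⟫ = b}`, `a ≠ 0`. -/
def SeparatedByHyperplane {d : ℕ} (A B : Set (EuclideanSpace ℝ (Fin d))) : Prop :=
  ∃ a : EuclideanSpace ℝ (Fin d), ∃ b : ℝ, a ≠ 0 ∧
    (∀ x ∈ A, inner ℝ a x < b) ∧ (∀ x ∈ B, b < inner ℝ a x)

/-- `c` is a system of constants `c(d, τ)` for the depth version of Carathéodory's theorem: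
it is positive for positive `τ`, and for every finite set `X` of at least `d + 1` points of `ℝ^d`
and every point `q` of positive Tukey depth `τ = τ_X(q)` there are pairwise disjoint
`X_1, …, X_{d+1} ⊆ X` with at least `c(d, τ) |X|` points each, such that `q` is in
`Conv {x_1, …, x_{d+1}}` for every choice of points `x_i ∈ X_i`. -/
def IsDepthCaratheodoryConstant (c : ℕ → ℝ → ℝ) : Prop :=
  (∀ d : ℕ, 1 ≤ d → ∀ τ : ℝ, 0 < τ → 0 < c d τ) ∧
  ∀ d : ℕ, 1 ≤ d → ∀ (X : Set (EuclideanSpace ℝ (Fin d))) (q : EuclideanSpace ℝ (Fin d)),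
    X.Finite → d + 1 ≤ X.ncard → 0 < tukeyDepth X q →
    ∃ Z : Fin (d + 1) → Set (EuclideanSpace ℝ (Fin d)),
      (∀ i, Z i ⊆ X) ∧
      (∀ i j, i ≠ j → Disjoint (Z i) (Z j)) ∧
      (∀ i, c d (tukeyDepth X q) * (X.ncard : ℝ) ≤ ((Z i).ncard : ℝ)) ∧
      ∀ x : Fin (d + 1) → EuclideanSpace ℝ (Fin d), (∀ i, x i ∈ Z i) →
        q ∈ convexHull ℝ (Set.range x)

/-!
The theorem rests on a depth version of Carathéodory's theorem for measures,
`exists_depthCaratheodory_measure`. Let `μ` be a finite measure on `ℝ^d` with bounded support, for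
which linear hyperplanes are null sets, and let every closed half-space whose boundary contains the
origin have at least the proportion `τ` of the mass. Then there are `d + 1` sets, each of measure
at least a constant times the total, every transversal of which has the origin in its convex hull.
The dual form of the conclusion is used throughout: the origin is in the convex hull of a finite
family unless some linear functional is positive on the whole family.

* A hyperplane through the origin and the centerpoints of all but one of at most `d` sets leaves a
  good part of each set on both sides, which replaces the ham-sandwich theorem and needs only
  Helly's theorem (`exists_centerpoint`, `exists_shrink_realizesSigns`). Iterating this, one shrinks
  any finite family of sets, by a constant factor, such that for any at most `d` of the sets and any
  choice of signs there is a linear functional with these signs on the sets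
  (`exists_realizesSigns`).
* No linear hyperplane crosses all of `d` such sets (`exists_uncrossed`). Hence boundedly many large
  clusters can be found such that every half-space of mass at least `τ` contains one of them
  (`exists_clusters`), that is, every transversal of the clusters captures the origin.
* After the clusters are shrunk again, Carathéodory's theorem selects `d + 1` of them for one
  transversal, and the selection is then good for every transversal
  (`zero_mem_convexHull_of_transversal`): moving one point inside its set cannot lose the origin,
  because a pivot would put the origin into the convex hull of points from only `d` of the sets,
  which lie in an open half-space.

Finite families of points follow by replacing each point by a small ball
(`exists_depthCaratheodory_family`); this costs a factor two in the depth and avoids all questions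
of general position. Disjointness of the sets is arranged afterwards with Hall's theorem
(`exists_depthCaratheodory`).

For the Kirchberger part, a point `x` of `R` is lifted to `(1, x)` and a point `x` of `B` to
`-(1, x)`. A linear functional that is negative on certain lifts separates the points underneath,
so if no `β n` points can be separated, the origin has depth more than `1 - β` among the lifts
(`exists_finset_signedLift`). The depth Carathéodory theorem in dimension `d + 1` then gives `d + 2`
large sets with no separable transversal (`exists_large_inseparable`). For `β = 1` Carathéodory's
theorem itself gives `d + 2` points that cannot be separated.
-/

open MeasureTheory Module Filter Topology

/-! ### Convex hulls and linear functionals -/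

section Convexity

variable {E : Type*} [NormedAddCommGroup E] [InnerProductSpace ℝ E]

theorem zero_mem_convexHull_range_of_weights {ι : Type*} [Fintype ι] {x : ι → E} {w : ι → ℝ}
    (hw : ∀ i, 0 ≤ w i) (hpos : 0 < ∑ i, w i) (h : ∑ i, w i • x i = 0) :
    (0 : E) ∈ convexHull ℝ (Set.range x) := by
  have := (convex_convexHull ℝ (Set.range x)).centerMass_mem (t := Finset.univ) (w := w) (z := x)
    (fun i _ => hw i) hpos (fun i _ => subset_convexHull ℝ _ ⟨i, rfl⟩)
  simpa [Finset.centerMass, h] using this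

theorem exists_inner_nonpos_of_zero_mem_convexHull {ι : Type*} {x : ι → E}
    (h : (0 : E) ∈ convexHull ℝ (Set.range x)) (a : E) : ∃ i, inner ℝ a (x i) ≤ 0 := by
  by_contra! hc
  have hsub : convexHull ℝ (Set.range x) ⊆ {y | 0 < inner ℝ a y} := by
    refine convexHull_min ?_ ?_
    · rintro _ ⟨i, rfl⟩
      exact hc i
    · exact convex_halfSpace_gt (f := fun y => inner ℝ a y)
        ⟨fun x y => inner_add_right _ _ _, fun c x => by simp [inner_smul_right]⟩ 0
  have := hsub h
  simp at this

theorem zero_mem_convexHull_range_iff [CompleteSpace E] {ι : Type*} [Finite ι] {x : ι → E} :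
    (0 : E) ∈ convexHull ℝ (Set.range x) ↔ ∀ a : E, ∃ i, inner ℝ a (x i) ≤ 0 := by
  refine ⟨exists_inner_nonpos_of_zero_mem_convexHull, fun h => ?_⟩
  by_contra hc
  obtain ⟨f, u, hu, hf⟩ := geometric_hahn_banach_point_closed (convex_convexHull ℝ (Set.range x))
    ((Set.finite_range x).isClosed_convexHull ℝ) hc
  obtain ⟨i, hi⟩ := h ((InnerProductSpace.toDual ℝ E).symm f)
  have := hf _ (subset_convexHull ℝ _ ⟨i, rfl⟩)
  rw [map_zero] at hu
  rw [InnerProductSpace.toDual_symm_apply] at hi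
  linarith

/-- Carathéodory's theorem for the convex hull of a finite family: the family `x ∘ k` is a
minimal subfamily with the origin in its convex hull. -/
theorem exists_caratheodory_subfamily {κ : Type*} {x : κ → E}
    (h : (0 : E) ∈ convexHull ℝ (Set.range x)) :
    ∃ (n : ℕ) (k : Fin n → κ), Function.Injective k ∧ AffineIndependent ℝ (x ∘ k) ∧
      (0 : E) ∈ convexHull ℝ (Set.range (x ∘ k)) := by
  obtain ⟨ι, _, z, w, hz, hind, hw, hsum, h0⟩ := eq_pos_convex_span_of_mem_convexHull h
  choose k hk using fun i => hz (Set.mem_range_self i)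
  let e := Fintype.equivFin ι
  have hxk : x ∘ (k ∘ e.symm) = z ∘ e.symm := by
    ext i
    simp [hk]
  refine ⟨Fintype.card ι, k ∘ e.symm, ?_, ?_, ?_⟩
  · have : Function.Injective (x ∘ (k ∘ e.symm)) := by
      rw [hxk]
      exact hind.injective.comp e.symm.injective
    exact this.of_comp
  · rw [hxk]
    exact hind.comp_embedding e.symm.toEmbedding
  · rw [hxk, e.symm.surjective.range_comp]
    exact zero_mem_convexHull_range_of_weights (fun i => (hw i).le) (by rw [hsum]; exact one_pos) h0

/-- If no `x i` can be avoided when the origin is written as a convex combination (because any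
proper subfamily lies in an open half-space), then all its coefficients are positive. -/
theorem exists_pos_weights_of_zero_mem_convexHull {ι : Type*} [Fintype ι] {x : ι → E}
    (hx : ∀ j, ∃ a : E, ∀ i, i ≠ j → 0 < inner ℝ a (x i))
    (h : (0 : E) ∈ convexHull ℝ (Set.range x)) :
    ∃ w : ι → ℝ, (∀ i, 0 < w i) ∧ ∑ i, w i • x i = 0 := by
  rw [convexHull_range_eq_exists_affineCombination] at h
  obtain ⟨s, w, hw, hsum, h0⟩ := h
  rw [Finset.affineCombination_eq_linear_combination _ _ _ hsum] at h0
  classical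
  let v : ι → ℝ := fun i => if i ∈ s then w i else 0
  have hv : ∀ i, 0 ≤ v i := fun i => by
    by_cases hi : i ∈ s
    · simp [v, hi, hw i hi]
    · simp [v, hi]
  have hv0 : ∑ i, v i • x i = 0 := by simpa [v, ite_smul] using h0
  have hv1 : ∑ i, v i = 1 := by simpa [v] using hsum
  refine ⟨v, fun j => lt_of_le_of_ne (hv j) fun hj => ?_, hv0⟩
  obtain ⟨a, ha⟩ := hx j
  have h1 : ∑ i, v i * inner ℝ a (x i) = 0 := by
    simpa [inner_sum, inner_smul_right] using congrArg (inner ℝ a) hv0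
  have hterm : ∀ i ∈ Finset.univ, 0 ≤ v i * inner ℝ a (x i) := fun i _ => by
    by_cases hij : i = j
    · simp [hij, ← hj]
    · exact mul_nonneg (hv i) (ha i hij).le
  have h2 := (Finset.sum_eq_zero_iff_of_nonneg hterm).1 h1
  have h3 : ∀ i, v i = 0 := fun i => by
    by_cases hij : i = j
    · rw [hij, ← hj]
    · exact (mul_eq_zero.1 (h2 i (Finset.mem_univ i))).resolve_right (ha i hij).ne'
  simp [h3] at hv1

/-- The pivoting step: `d + 1` sets in `ℝ^d`, any `d` of which lie in a common open half-space
bounded by a linear hyperplane. Whether a transversal captures the origin does not change when one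
of its points is moved inside its set. -/
theorem zero_mem_convexHull_update [FiniteDimensional ℝ E] {ι : Type*} [Fintype ι] [DecidableEq ι]
    (hι : Fintype.card ι = finrank ℝ E + 1) {S : ι → Set E}
    (hS : ∀ j, ∃ a : E, ∀ i, i ≠ j → ∀ z ∈ S i, 0 < inner ℝ a z)
    {x : ι → E} (hx : ∀ i, x i ∈ S i) (h : (0 : E) ∈ convexHull ℝ (Set.range x))
    (k : ι) {y : E} (hy : y ∈ S k) :
    (0 : E) ∈ convexHull ℝ (Set.range (Function.update x k y)) := by
  obtain ⟨l, hl, hl0⟩ := exists_pos_weights_of_zero_mem_convexHull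
    (fun j => (hS j).imp fun a ha i hij => ha i hij _ (hx i)) h
  set x' := Function.update x k y with hx'
  have hx'k : x' k = y := by simp [hx']
  have hx'i : ∀ i, i ≠ k → x' i = x i := fun i hi => by simp [hx', hi]
  -- a nontrivial linear relation between the new points, normalised at the index `k`
  have hdep : ∃ m : ι → ℝ, ∑ i, m i • x' i = 0 ∧ (∃ i, m i ≠ 0) ∧ 0 ≤ m k := by
    have hnot : ¬ LinearIndependent ℝ x' := fun hli => by
      have := hli.fintype_card_le_finrank
      omega
    obtain ⟨m, hm, hne⟩ := Fintype.not_linearIndependent_iff.1 hnot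
    rcases le_total 0 (m k) with h0 | h0
    · exact ⟨m, hm, hne, h0⟩
    · refine ⟨fun i => -m i, ?_, ?_, by simpa using h0⟩
      · simp [hm]
      · simpa using hne
  obtain ⟨m, hm, hne, hmk⟩ := hdep
  by_cases hall : ∀ i, 0 ≤ m i
  · refine zero_mem_convexHull_range_of_weights hall ?_ hm
    obtain ⟨i, hi⟩ := hne
    exact Finset.sum_pos' (fun i _ => hall i) ⟨i, Finset.mem_univ i, lt_of_le_of_ne (hall i) hi.symm⟩
  exfalso
  push Not at hall
  -- the ratio test: `j` is the first index whose coefficient vanishes in `l + s • m`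
  obtain ⟨j, hj, hmin⟩ := Finset.exists_min_image (Finset.univ.filter fun i => m i < 0)
    (fun i => l i / -m i) (by
      obtain ⟨i, hi⟩ := hall
      exact ⟨i, by simpa using hi⟩)
  simp only [Finset.mem_filter, Finset.mem_univ, true_and] at hj hmin
  set s := l j / -m j with hs
  have hs0 : 0 < s := div_pos (hl j) (by linarith)
  have hjk : j ≠ k := fun h => by rw [h] at hj; linarith
  have hcj : l j + s * m j = 0 := by
    rw [hs]
    field_simp [hj.ne]
    ring
  have hci : ∀ i, 0 ≤ l i + s * m i := fun i => by
    rcases lt_or_ge (m i) 0 with hi | hi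
    · have := hmin i hi
      rw [le_div_iff₀ (by linarith)] at this
      linarith
    · have := mul_nonneg hs0.le hi
      linarith [hl i]
  obtain ⟨a, ha⟩ := hS j
  have h1 : ∑ i, (l i * inner ℝ a (x i) + s * (m i * inner ℝ a (x' i))) = 0 := by
    have e1 : ∑ i, l i * inner ℝ a (x i) = 0 := by
      simpa [inner_sum, inner_smul_right] using congrArg (inner ℝ a) hl0
    have e2 : ∑ i, m i * inner ℝ a (x' i) = 0 := by
      simpa [inner_sum, inner_smul_right] using congrArg (inner ℝ a) hm
    rw [Finset.sum_add_distrib, ← Finset.mul_sum, e1, e2]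
    simp
  have h2 : 0 < ∑ i, (l i * inner ℝ a (x i) + s * (m i * inner ℝ a (x' i))) := by
    refine Finset.sum_pos' (fun i _ => ?_) ⟨k, Finset.mem_univ k, ?_⟩
    · by_cases hik : i = k
      · subst hik
        rw [hx'k]
        have p1 := mul_pos (hl i) (ha i hjk.symm _ (hx i))
        have p2 := mul_nonneg hs0.le (mul_nonneg hmk (ha i hjk.symm _ hy).le)
        linarith
      · rw [hx'i i hik]
        have e : l i * inner ℝ a (x i) + s * (m i * inner ℝ a (x i))
            = (l i + s * m i) * inner ℝ a (x i) := by ring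
        rw [e]
        by_cases hij : i = j
        · rw [hij, hcj, zero_mul]
        · exact mul_nonneg (hci i) (ha i hij _ (hx i)).le
    · rw [hx'k]
      have p1 := mul_pos (hl k) (ha k hjk.symm _ (hx k))
      have p2 := mul_nonneg hs0.le (mul_nonneg hmk (ha k hjk.symm _ hy).le)
      linarith
  linarith

/-- For `d + 1` sets in `ℝ^d` any `d` of which lie in a common open half-space bounded by a linear
hyperplane, either every transversal captures the origin or none does. -/
theorem zero_mem_convexHull_of_transversal [FiniteDimensional ℝ E] {ι : Type*} [Fintype ι]
    (hι : Fintype.card ι = finrank ℝ E + 1) {S : ι → Set E}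
    (hS : ∀ j, ∃ a : E, ∀ i, i ≠ j → ∀ z ∈ S i, 0 < inner ℝ a z)
    {x y : ι → E} (hx : ∀ i, x i ∈ S i) (hy : ∀ i, y i ∈ S i)
    (h : (0 : E) ∈ convexHull ℝ (Set.range x)) : (0 : E) ∈ convexHull ℝ (Set.range y) := by
  classical
  have key : ∀ T : Finset ι, (0 : E) ∈ convexHull ℝ (Set.range (T.piecewise y x)) := fun T => by
    induction T using Finset.induction_on with
    | empty => simpa using h
    | insert k T _ ih =>
      rw [Finset.piecewise_insert]
      refine zero_mem_convexHull_update hι hS (fun i => ?_) ih k (hy k)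
      by_cases hi : i ∈ T <;> simp [hi, hx, hy]
  simpa using key Finset.univ

/-- `a` realises the sign pattern `J` on the family `Z` restricted to `I`: it is positive on `Z i`
for `i ∈ I ∩ J` and negative on `Z i` for `i ∈ I \ J`. -/
def RealizesSigns {ι : Type*} (Z : ι → Set E) (I J : Finset ι) (a : E) : Prop :=
  ∀ i ∈ I, ∀ z ∈ Z i, (i ∈ J → 0 < inner ℝ a z) ∧ (i ∉ J → inner ℝ a z < 0)

theorem RealizesSigns.mono {ι : Type*} {Z Z' : ι → Set E} {I J : Finset ι} {a : E}
    (h : RealizesSigns Z I J a) (hZ : ∀ i, Z' i ⊆ Z i) : RealizesSigns Z' I J a :=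
  fun i hi z hz => h i hi z (hZ i hz)

/-- If all sign patterns are realised on `d` sets in `ℝ^d`, then no linear hyperplane meets the
convex hulls of all of them: a choice of one point on the hyperplane from each hull would be
linearly dependent, contrary to the functional with the signs of the dependence. -/
theorem exists_uncrossed [FiniteDimensional ℝ E] {ι : Type*} [Fintype ι]
    (hι : Fintype.card ι = finrank ℝ E) {Z : ι → Set E}
    (hZ : ∀ J : Finset ι, ∃ a : E, RealizesSigns Z Finset.univ J a) {a : E} (ha : a ≠ 0) :
    ∃ i, (∀ z ∈ Z i, 0 < inner ℝ a z) ∨ (∀ z ∈ Z i, inner ℝ a z < 0) := by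
  classical
  by_contra! hc
  have hz : ∀ i, ∃ z ∈ convexHull ℝ (Z i), inner ℝ a z = 0 := fun i => by
    obtain ⟨⟨p, hp, hp0⟩, q, hq, hq0⟩ := hc i
    have hpre : IsPreconnected ((fun z => inner ℝ a z) '' convexHull ℝ (Z i)) :=
      (convex_convexHull ℝ (Z i)).isPreconnected.image _ (by fun_prop)
    exact hpre.ordConnected.out ⟨p, subset_convexHull ℝ _ hp, rfl⟩
      ⟨q, subset_convexHull ℝ _ hq, rfl⟩ ⟨hp0, hq0⟩
  choose z hzmem hz0 using hz
  have hnot : ¬ LinearIndependent ℝ z := fun hli => by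
    have hspan := hli.span_eq_top_of_card_eq_finrank' hι
    have hle : Submodule.span ℝ (Set.range z) ≤ (ℝ ∙ a)ᗮ := by
      rw [Submodule.span_le]
      rintro _ ⟨i, rfl⟩
      exact (Submodule.mem_orthogonal_singleton_iff_inner_right).2 (hz0 i)
    rw [hspan] at hle
    have := (Submodule.mem_orthogonal_singleton_iff_inner_right).1 (hle (Submodule.mem_top (x := a)))
    exact ha (inner_self_eq_zero.1 this)
  obtain ⟨g, hg, k, hk⟩ := Fintype.not_linearIndependent_iff.1 hnot
  obtain ⟨b, hb⟩ := hZ (Finset.univ.filter fun i => 0 < g i)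
  have hlin : IsLinearMap ℝ (fun y : E => inner ℝ b y) :=
    ⟨fun x y => inner_add_right _ _ _, fun c x => by simp [inner_smul_right]⟩
  have hpos : ∀ i, 0 < g i → 0 < inner ℝ b (z i) := fun i hi =>
    convexHull_min (fun y hy => (hb i (Finset.mem_univ i) y hy).1 (by simpa using hi))
      (convex_halfSpace_gt hlin 0) (hzmem i)
  have hneg : ∀ i, ¬ 0 < g i → inner ℝ b (z i) < 0 := fun i hi =>
    convexHull_min (fun y hy => (hb i (Finset.mem_univ i) y hy).2 (by simpa using hi))
      (convex_halfSpace_lt hlin 0) (hzmem i)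
  have h0 : ∑ i, g i * inner ℝ b (z i) = 0 := by
    simpa [inner_sum, inner_smul_right] using congrArg (inner ℝ b) hg
  have h1 : 0 < ∑ i, g i * inner ℝ b (z i) := by
    refine Finset.sum_pos' (fun i _ => ?_) ⟨k, Finset.mem_univ k, ?_⟩
    · by_cases hi : 0 < g i
      · exact (mul_pos hi (hpos i hi)).le
      · exact mul_nonneg_of_nonpos_of_nonpos (not_lt.1 hi) (hneg i hi).le
    · by_cases hi : 0 < g k
      · exact mul_pos hi (hpos k hi)
      · exact mul_pos_of_neg_of_neg (lt_of_le_of_ne (not_lt.1 hi) hk) (hneg k hi)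
  linarith

end Convexity

/-! ### Centerpoints of measures -/

section Measures

variable {E : Type*} [NormedAddCommGroup E] [InnerProductSpace ℝ E] [FiniteDimensional ℝ E]
  [MeasurableSpace E] [BorelSpace E]

/-- The centerpoint theorem for a finite measure with bounded support: by Helly's theorem, the
closed half-spaces whose complement has measure less than `1 / (d + 1)` of the total have a common
point. -/
theorem exists_centerpoint (μ : Measure E) [IsFiniteMeasure μ] {R : ℝ}
    (hR : μ (Metric.closedBall 0 R)ᶜ = 0) :
    ∃ p : E, ∀ a : E,
      μ.real Set.univ ≤ (finrank ℝ E + 1) * μ.real {x | inner ℝ a p ≤ inner ℝ a x} := by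
  let ι := {h : E × ℝ // (finrank ℝ E + 1) * μ.real {x | h.2 < inner ℝ h.1 x} < μ.real Set.univ}
  let F : ι → Set E := fun h => {x | inner ℝ h.1.1 x ≤ h.1.2} ∩ Metric.closedBall 0 R
  have hF : (⋂ i, F i).Nonempty := by
    refine Convex.helly_theorem_compact' (𝕜 := ℝ) (fun h => ?_) (fun h => ?_) (fun I hI => ?_)
    · exact (convex_halfSpace_le (f := fun y => inner ℝ h.1.1 y)
        ⟨fun x y => inner_add_right _ _ _, fun c x => by simp [inner_smul_right]⟩ _).inter
        (convex_closedBall 0 R)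
    · exact (isCompact_closedBall 0 R).inter_left (isClosed_le (by fun_prop) continuous_const)
    · rcases I.eq_empty_or_nonempty with rfl | hne
      · simp
      by_contra hc
      rw [Set.not_nonempty_iff_eq_empty] at hc
      have hcover : Set.univ ⊆ (Metric.closedBall (0 : E) R)ᶜ ∪
          ⋃ i ∈ I, {x : E | i.1.2 < inner ℝ i.1.1 x} := by
        intro x _
        by_contra hx
        simp only [Set.mem_union, Set.mem_compl_iff, not_or, not_not, Set.mem_iUnion,
          Set.mem_ofPred_eq, not_exists, not_lt] at hx
        have : x ∈ ⋂ i ∈ I, F i := by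
          simp only [Set.mem_iInter]
          exact fun i hi => ⟨hx.2 i hi, hx.1⟩
        rw [hc] at this
        exact this
      have h1 : μ.real Set.univ ≤ ∑ i ∈ I, μ.real {x : E | i.1.2 < inner ℝ i.1.1 x} := by
        refine (measureReal_mono hcover).trans ((measureReal_union_le _ _).trans ?_)
        rw [measureReal_def, hR, ENNReal.toReal_zero, zero_add]
        exact measureReal_biUnion_finset_le _ _
      have h2 : (finrank ℝ E + 1) * ∑ i ∈ I, μ.real {x : E | i.1.2 < inner ℝ i.1.1 x}
          < ∑ i ∈ I, μ.real Set.univ := by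
        rw [Finset.mul_sum]
        exact Finset.sum_lt_sum_of_nonempty hne fun i _ => i.2
      rw [Finset.sum_const, nsmul_eq_mul] at h2
      have h3 : (I.card : ℝ) ≤ finrank ℝ E + 1 := by exact_mod_cast hI
      have h4 := mul_le_mul_of_nonneg_right h3 (measureReal_nonneg (μ := μ) (s := Set.univ))
      have h5 := mul_le_mul_of_nonneg_left h1 (by positivity : (0 : ℝ) ≤ finrank ℝ E + 1)
      linarith
  obtain ⟨p, hp⟩ := hF
  refine ⟨p, fun a => ?_⟩
  by_contra! hlt
  -- the closed half-space at `p` is a decreasing limit of larger open ones, which are still light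
  let u : ℕ → Set E := fun n => {x | inner ℝ a p - 1 / ((n : ℝ) + 1) < inner ℝ a x}
  have hu : ⋂ n, u n = {x | inner ℝ a p ≤ inner ℝ a x} := by
    ext x
    simp only [u, Set.mem_iInter, Set.mem_ofPred_eq]
    constructor
    · intro h
      have hlim : Tendsto (fun n : ℕ => inner ℝ a p - 1 / ((n : ℝ) + 1)) atTop
          (𝓝 (inner ℝ a p - 0)) :=
        tendsto_const_nhds.sub tendsto_one_div_add_atTop_nhds_zero_nat
      rw [sub_zero] at hlim
      exact le_of_tendsto' hlim (fun n => (h n).le)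
    · intro h n
      have : (0 : ℝ) < 1 / ((n : ℝ) + 1) := by positivity
      linarith
  have hanti : Antitone u := by
    intro m n hmn x hx
    simp only [u, Set.mem_ofPred_eq] at hx ⊢
    have := one_div_le_one_div_of_le (by positivity : (0 : ℝ) < (m : ℝ) + 1)
      (by exact_mod_cast Nat.succ_le_succ hmn : (m : ℝ) + 1 ≤ (n : ℝ) + 1)
    linarith
  have hmeas : ∀ n, MeasurableSet (u n) := fun n =>
    (isOpen_lt continuous_const (by fun_prop)).measurableSet
  have ht := tendsto_measure_iInter_atTop (μ := μ) (fun n => (hmeas n).nullMeasurableSet) hanti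
    ⟨0, measure_ne_top μ _⟩
  rw [hu] at ht
  have ht' : Tendsto (fun n => (finrank ℝ E + 1) * μ.real (u n)) atTop
      (𝓝 ((finrank ℝ E + 1) * μ.real {x | inner ℝ a p ≤ inner ℝ a x})) :=
    ((ENNReal.tendsto_toReal (measure_ne_top μ _)).comp ht).const_mul _
  obtain ⟨n, hn⟩ := (ht'.eventually_lt_const hlt).exists
  have hmem := Set.mem_iInter.1 hp ⟨(a, inner ℝ a p - 1 / ((n : ℝ) + 1)), hn⟩
  have h6 : inner ℝ a p ≤ inner ℝ a p - 1 / ((n : ℝ) + 1) := hmem.1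
  have : (0 : ℝ) < 1 / ((n : ℝ) + 1) := by positivity
  linarith

/-! ### Realising sign patterns on large subsets -/

/-- A measure with bounded support for which linear hyperplanes are null sets. -/
structure IsSpread (μ : Measure E) : Prop where
  null_hyperplane : ∀ a : E, a ≠ 0 → μ {x | inner ℝ a x = 0} = 0
  bounded : ∃ R : ℝ, μ (Metric.closedBall 0 R)ᶜ = 0

/-- A weak substitute for the ham-sandwich theorem. A linear hyperplane through the centerpoints
of all the given sets but one has a good part of each of these sets on both sides, and it can be
oriented according to the remaining set. -/
theorem exists_shrink_realizesSigns (hd : 0 < finrank ℝ E) {μ : Measure E} [IsFiniteMeasure μ]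
    (hμ : IsSpread μ) {ι : Type*} {Z : ι → Set E} (hZ : ∀ i, MeasurableSet (Z i))
    (I J : Finset ι) (hI : I.card ≤ finrank ℝ E) :
    ∃ Z' : ι → Set E, (∀ i, Z' i ⊆ Z i) ∧ (∀ i, MeasurableSet (Z' i)) ∧
      (∀ i, μ.real (Z i) ≤ (finrank ℝ E + 1) * μ.real (Z' i)) ∧ ∃ a, RealizesSigns Z' I J a := by
  classical
  have htriv : ∀ t : ℝ, 0 ≤ t → t ≤ (finrank ℝ E + 1) * t := fun t ht => by
    have : 0 ≤ (finrank ℝ E : ℝ) * t := by positivity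
    linarith
  rcases I.eq_empty_or_nonempty with rfl | ⟨i₀, hi₀⟩
  · exact ⟨Z, fun i => subset_rfl, hZ, fun i => htriv _ measureReal_nonneg, 0,
      fun i hi => by simp at hi⟩
  let s : ι → ℝ := fun i => if i ∈ J then 1 else -1
  have hs : ∀ i, s i ≠ 0 := fun i => by by_cases hi : i ∈ J <;> simp [s, hi]
  obtain ⟨R, hR⟩ := hμ.bounded
  have hp : ∀ i, ∃ p : E, ∀ a : E, μ.real (Z i) ≤
      (finrank ℝ E + 1) * μ.real (Z i ∩ {x | inner ℝ a p ≤ inner ℝ a x}) := fun i => by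
    have hRi : μ.restrict (Z i) (Metric.closedBall 0 R)ᶜ = 0 :=
      le_antisymm ((Measure.restrict_apply_le (Z i) _).trans hR.le) zero_le
    obtain ⟨p, hp⟩ := exists_centerpoint (μ.restrict (Z i)) hRi
    refine ⟨p, fun a => ?_⟩
    have := hp a
    rw [measureReal_restrict_apply MeasurableSet.univ, Set.univ_inter,
      measureReal_restrict_apply (isClosed_le continuous_const (by fun_prop)).measurableSet] at this
    rwa [Set.inter_comm]
  choose p hp using hp
  have ha : ∃ a : E, a ≠ 0 ∧ ∀ i ∈ I.erase i₀, inner ℝ a (p i) = 0 := by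
    let V := Submodule.span ℝ (((I.erase i₀).image p : Finset E) : Set E)
    have hV : finrank ℝ V < finrank ℝ E := by
      have h1 : finrank ℝ V ≤ ((I.erase i₀).image p).card := finrank_span_finset_le_card _
      have h2 : ((I.erase i₀).image p).card ≤ (I.erase i₀).card := Finset.card_image_le
      have h3 := Finset.card_erase_lt_of_mem hi₀
      omega
    have hVbot : Vᗮ ≠ ⊥ := fun h => by
      rw [Submodule.orthogonal_eq_bot_iff] at h
      rw [h, finrank_top] at hV
      exact lt_irrefl _ hV
    obtain ⟨a, ha, ha0⟩ := Submodule.exists_mem_ne_zero_of_ne_bot hVbot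
    refine ⟨a, ha0, fun i hi => ?_⟩
    rw [real_inner_comm]
    exact (Submodule.mem_orthogonal _ _).1 ha _
      (Submodule.subset_span (by exact_mod_cast Finset.mem_image_of_mem p hi))
  obtain ⟨a, ha0, ha⟩ := ha
  -- the orientation of the hyperplane is chosen so that the remaining set is cut well, too
  have hb : ∃ b : E, b ≠ 0 ∧ (∀ i ∈ I.erase i₀, inner ℝ b (p i) = 0) ∧
      μ.real (Z i₀) ≤ (finrank ℝ E + 1) * μ.real (Z i₀ ∩ {x | 0 ≤ s i₀ * inner ℝ b x}) := by
    by_contra! hc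
    have h1 := hc a ha0 ha
    have h2 := hc (-a) (neg_ne_zero.2 ha0) (fun i hi => by simp [ha i hi])
    have hsub : Z i₀ ⊆ (Z i₀ ∩ {x | 0 ≤ s i₀ * inner ℝ a x}) ∪
        (Z i₀ ∩ {x | 0 ≤ s i₀ * inner ℝ (-a) x}) := fun x hx => by
      rcases le_total 0 (s i₀ * inner ℝ a x) with h | h
      · exact Or.inl ⟨hx, h⟩
      · refine Or.inr ⟨hx, ?_⟩
        simpa using h
    have h3 := (measureReal_mono (μ := μ) hsub).trans (measureReal_union_le _ _)
    have hd' : (1 : ℝ) ≤ finrank ℝ E := by exact_mod_cast hd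
    have h4 := mul_le_mul_of_nonneg_left h3 (by positivity : (0 : ℝ) ≤ finrank ℝ E + 1)
    have h5 := mul_le_mul_of_nonneg_right hd' (measureReal_nonneg (μ := μ) (s := Z i₀))
    linarith
  obtain ⟨b, hb0, hb, hbi₀⟩ := hb
  have hclosed : ∀ i ∈ I, μ.real (Z i) ≤
      (finrank ℝ E + 1) * μ.real (Z i ∩ {x | 0 ≤ s i * inner ℝ b x}) := fun i hi => by
    by_cases hii : i = i₀
    · rwa [hii]
    · have h := hp i (s i • b)
      rw [real_inner_smul_left, hb i (Finset.mem_erase.2 ⟨hii, hi⟩), mul_zero] at h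
      simpa only [real_inner_smul_left] using h
  have hmeas : ∀ i, MeasurableSet {x : E | 0 < s i * inner ℝ b x} := fun i =>
    (isOpen_lt continuous_const (by fun_prop)).measurableSet
  refine ⟨fun i => if i ∈ I then Z i ∩ {x | 0 < s i * inner ℝ b x} else Z i, fun i => ?_,
    fun i => ?_, fun i => ?_, b, fun i hi z hz => ?_⟩
  · by_cases hi : i ∈ I <;> simp [hi]
  · by_cases hi : i ∈ I
    · simpa [hi] using (hZ i).inter (hmeas i)
    · simpa [hi] using hZ i
  · by_cases hi : i ∈ I
    · simp only [hi, if_true]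
      refine (hclosed i hi).trans (mul_le_mul_of_nonneg_left ?_ (by positivity))
      have hsub : Z i ∩ {x | 0 ≤ s i * inner ℝ b x} ⊆
          (Z i ∩ {x | 0 < s i * inner ℝ b x}) ∪ {x | inner ℝ b x = 0} := fun x hx => by
        rcases lt_or_eq_of_le (show 0 ≤ s i * inner ℝ b x from hx.2) with h | h
        · exact Or.inl ⟨hx.1, h⟩
        · exact Or.inr ((mul_eq_zero.1 h.symm).resolve_left (hs i))
      have h := (measureReal_mono (μ := μ) hsub).trans (measureReal_union_le _ _)
      rwa [measureReal_def μ {x | inner ℝ b x = 0}, hμ.null_hyperplane b hb0, ENNReal.toReal_zero,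
        add_zero] at h
    · simp only [hi, if_false]
      exact htriv _ measureReal_nonneg
  · simp only [hi, if_true] at hz
    have h : 0 < s i * inner ℝ b z := hz.2
    constructor
    · intro hJ
      simpa [s, hJ] using h
    · intro hJ
      simpa [s, hJ] using h

/-- A same-type lemma: any finite family of sets has large subsets on which, for any at most `d`
of the indices, all sign patterns are realised. -/
theorem exists_realizesSigns (hd : 0 < finrank ℝ E) (ι : Type*) [Fintype ι] :
    ∃ c : ℝ, 0 < c ∧ c < 1 ∧ ∀ (μ : Measure E) [IsFiniteMeasure μ], IsSpread μ →
      ∀ Z : ι → Set E, (∀ i, MeasurableSet (Z i)) →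
      ∃ Z' : ι → Set E, (∀ i, Z' i ⊆ Z i) ∧ (∀ i, MeasurableSet (Z' i)) ∧
        (∀ i, c * μ.real (Z i) ≤ μ.real (Z' i)) ∧
        ∀ I J : Finset ι, I.card ≤ finrank ℝ E → ∃ a, RealizesSigns Z' I J a := by
  classical
  set r : ℝ := ((finrank ℝ E : ℝ) + 1)⁻¹ with hr
  have hr0 : 0 < r := by positivity
  have hr1 : r < 1 := inv_lt_one_of_one_lt₀ (by
    have : (1 : ℝ) ≤ finrank ℝ E := by exact_mod_cast hd
    linarith)
  have key : ∀ (T : Finset (Finset ι × Finset ι)) (μ : Measure E) [IsFiniteMeasure μ],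
      IsSpread μ → ∀ Z : ι → Set E, (∀ i, MeasurableSet (Z i)) →
      ∃ Z' : ι → Set E, (∀ i, Z' i ⊆ Z i) ∧ (∀ i, MeasurableSet (Z' i)) ∧
        (∀ i, r ^ T.card * μ.real (Z i) ≤ μ.real (Z' i)) ∧
        ∀ P ∈ T, P.1.card ≤ finrank ℝ E → ∃ a, RealizesSigns Z' P.1 P.2 a := by
    intro T μ _ hμ Z hZ
    induction T using Finset.induction_on with
    | empty => exact ⟨Z, fun i => subset_rfl, hZ, fun i => by simp, fun P hP => by simp at hP⟩
    | insert P T hPT ih =>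
      obtain ⟨Y, hYZ, hYm, hY, hYT⟩ := ih
      by_cases hP : P.1.card ≤ finrank ℝ E
      · obtain ⟨Y', hY'Y, hY'm, hY', a, ha⟩ := exists_shrink_realizesSigns hd hμ hYm P.1 P.2 hP
        refine ⟨Y', fun i => (hY'Y i).trans (hYZ i), hY'm, fun i => ?_, fun Q hQ hQc => ?_⟩
        · rw [Finset.card_insert_of_notMem hPT, pow_succ', mul_assoc, hr,
            inv_mul_le_iff₀ (by positivity), ← hr]
          exact (hY i).trans (hY' i)
        · rcases Finset.mem_insert.1 hQ with rfl | hQ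
          · exact ⟨a, ha⟩
          · exact (hYT Q hQ hQc).imp fun b hb => hb.mono hY'Y
      · refine ⟨Y, hYZ, hYm, fun i => ?_, fun Q hQ hQc => ?_⟩
        · refine le_trans (mul_le_mul_of_nonneg_right ?_ measureReal_nonneg) (hY i)
          exact pow_le_pow_of_le_one hr0.le hr1.le (Finset.card_le_card (Finset.subset_insert _ _))
        · rcases Finset.mem_insert.1 hQ with rfl | hQ
          · exact absurd hQc hP
          · exact hYT Q hQ hQc
  refine ⟨r ^ (Finset.univ : Finset (Finset ι × Finset ι)).card, by positivity,
    pow_lt_one₀ hr0.le hr1 (Finset.card_ne_zero.2 Finset.univ_nonempty), fun μ _ hμ Z hZ => ?_⟩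
  obtain ⟨Z', h1, h2, h3, h4⟩ := key Finset.univ μ hμ Z hZ
  exact ⟨Z', h1, h2, h3, fun I J hI => h4 (I, J) (Finset.mem_univ _) hI⟩

/-! ### Clusters inside heavy half-spaces -/

/-- Boundedly many large subsets of `Z` such that every half-space (bounded by a linear
hyperplane) that contains a given proportion `q ^ L` of `Z` contains one of them entirely. For the
inductive step take `d` copies of `Z` and shrink them so that no hyperplane crosses all of them. A
shrunken set `W i` not crossed by the boundary lies in the half-space, or it is disjoint from it,
and then the half-space contains a larger proportion of `Z \ W i`. -/
theorem exists_clusters (hd : 0 < finrank ℝ E) :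
    ∃ q : ℝ, 0 < q ∧ q < 1 ∧ ∀ L : ℕ, ∃ (κ : Type) (_ : Fintype κ) (c : ℝ), 0 < c ∧ c ≤ 1 ∧
      ∀ (μ : Measure E) [IsFiniteMeasure μ], IsSpread μ → ∀ Z : Set E, MeasurableSet Z →
      ∃ C : κ → Set E, (∀ k, C k ⊆ Z) ∧ (∀ k, MeasurableSet (C k)) ∧
        (∀ k, c * μ.real Z ≤ μ.real (C k)) ∧
        ∀ a : E, a ≠ 0 → q ^ L * μ.real Z < μ.real (Z ∩ {x | 0 ≤ inner ℝ a x}) →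
          ∃ k, ∀ x ∈ C k, 0 ≤ inner ℝ a x := by
  obtain ⟨c₀, hc₀, hc₀1, hsame⟩ := exists_realizesSigns hd (Fin (finrank ℝ E))
  refine ⟨1 - c₀, by linarith, by linarith, fun L => ?_⟩
  set q := 1 - c₀ with hq
  have hq0 : 0 < q := by linarith
  have hq1 : q ≤ 1 := by linarith
  induction L with
  | zero =>
    refine ⟨Empty, inferInstance, 1, one_pos, le_rfl, fun μ _ _ Z _ => ⟨Empty.elim, fun k => k.elim,
      fun k => k.elim, fun k => k.elim, fun a _ h => ?_⟩⟩
    rw [pow_zero, one_mul] at h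
    exact absurd (measureReal_mono (μ := μ) Set.inter_subset_left) (not_le.2 h)
  | succ L ih =>
    obtain ⟨κ, _, c, hc, hc1, ih⟩ := ih
    have hqL : 0 < q ^ (L + 1) := pow_pos hq0 _
    have hqL1 : q ^ (L + 1) ≤ 1 := pow_le_one₀ hq0.le hq1
    refine ⟨Fin (finrank ℝ E) ⊕ Fin (finrank ℝ E) × κ, inferInstance, min c₀ (c * q ^ (L + 1)),
      lt_min hc₀ (mul_pos hc hqL), (min_le_left _ _).trans hc₀1.le, fun μ _ hμ Z hZ => ?_⟩
    obtain ⟨W, hWZ, hWm, hW, hsign⟩ := hsame μ hμ (fun _ => Z) (fun _ => hZ)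
    have hdiff : ∀ i, μ.real (Z \ W i) ≤ q * μ.real Z := fun i => by
      rw [measureReal_sdiff (hWZ i) (hWm i)]
      have := hW i
      rw [hq]
      linarith
    choose C hCZ hCm hC hCa using fun i => ih μ hμ (Z \ W i) (hZ.diff (hWm i))
    classical
    -- the clusters inside `Z \ W i` are used only if `Z \ W i` is not too small
    refine ⟨Sum.elim W fun ik => if q ^ (L + 1) * μ.real Z ≤ μ.real (Z \ W ik.1) then C ik.1 ik.2
      else Z, ?_, ?_, ?_, fun a ha hlt => ?_⟩
    · rintro (i | ⟨i, k⟩)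
      · exact hWZ i
      · simp only [Sum.elim_inr]
        split_ifs
        · exact (hCZ i k).trans Set.sdiff_subset
        · exact subset_rfl
    · rintro (i | ⟨i, k⟩)
      · exact hWm i
      · simp only [Sum.elim_inr]
        split_ifs
        · exact hCm i k
        · exact hZ
    · have hZ0 : 0 ≤ μ.real Z := measureReal_nonneg
      rintro (i | ⟨i, k⟩)
      · exact (mul_le_mul_of_nonneg_right (min_le_left _ _) hZ0).trans (hW i)
      · simp only [Sum.elim_inr]
        refine (mul_le_mul_of_nonneg_right (min_le_right _ _) hZ0).trans ?_
        split_ifs with h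
        · refine le_trans ?_ (hC i k)
          rw [mul_assoc]
          exact mul_le_mul_of_nonneg_left h hc.le
        · exact mul_le_of_le_one_left hZ0 (mul_le_one₀ hc1 hqL.le hqL1)
    · obtain ⟨i, hi⟩ := exists_uncrossed (Fintype.card_fin _)
        (fun J => hsign Finset.univ J (by simp)) ha
      rcases hi with hi | hi
      · exact ⟨Sum.inl i, fun x hx => (hi x hx).le⟩
      · have heq : Z ∩ {x | 0 ≤ inner ℝ a x} = (Z \ W i) ∩ {x | 0 ≤ inner ℝ a x} := by
          ext x
          constructor
          · rintro ⟨hx, hx0⟩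
            exact ⟨⟨hx, fun hxW => absurd hx0 (not_le.2 (hi x hxW))⟩, hx0⟩
          · rintro ⟨hx, hx0⟩
            exact ⟨hx.1, hx0⟩
        have hlarge : q ^ (L + 1) * μ.real Z ≤ μ.real (Z \ W i) := by
          rw [heq] at hlt
          exact hlt.le.trans (measureReal_mono Set.inter_subset_left)
        obtain ⟨k, hk⟩ := hCa i a ha (by
          rw [← heq]
          refine lt_of_le_of_lt ?_ hlt
          rw [pow_succ, mul_assoc]
          exact mul_le_mul_of_nonneg_left (hdiff i) (pow_nonneg hq0.le L))
        refine ⟨Sum.inr (i, k), fun x hx => hk x ?_⟩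
        simpa only [Sum.elim_inr, if_pos hlarge] using hx

/-! ### The depth Carathéodory theorem for measures -/

/-- The depth Carathéodory theorem for measures: every transversal of the refined clusters captures
the origin, Carathéodory's theorem selects `d + 1` of the clusters for one transversal, and by
`zero_mem_convexHull_of_transversal` the choice is good for all transversals. -/
theorem exists_depthCaratheodory_measure (hd : 0 < finrank ℝ E) {τ : ℝ} (hτ : 0 < τ) :
    ∃ c : ℝ, 0 < c ∧ ∀ (μ : Measure E) [IsFiniteMeasure μ], IsSpread μ → 0 < μ.real Set.univ →
      (∀ a : E, a ≠ 0 → τ * μ.real Set.univ ≤ μ.real {x | 0 ≤ inner ℝ a x}) →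
      ∃ S : Fin (finrank ℝ E + 1) → Set E,
        (∀ i, c * μ.real Set.univ ≤ μ.real (S i)) ∧
        ∀ x : Fin (finrank ℝ E + 1) → E, (∀ i, x i ∈ S i) →
          (0 : E) ∈ convexHull ℝ (Set.range x) := by
  classical
  obtain ⟨q, hq0, hq1, hclust⟩ := exists_clusters hd
  obtain ⟨L, hL⟩ := exists_pow_lt_of_lt_one hτ hq1
  obtain ⟨κ, _, c₁, hc₁, -, hclust⟩ := hclust L
  obtain ⟨c₂, hc₂, -, hsame⟩ := exists_realizesSigns hd κ
  refine ⟨c₂ * c₁, mul_pos hc₂ hc₁, fun μ _ hμ hpos hdepth => ?_⟩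
  obtain ⟨C, -, hCm, hC, hCa⟩ := hclust μ hμ Set.univ MeasurableSet.univ
  obtain ⟨D, hDC, -, hD, hsign⟩ := hsame μ hμ C hCm
  have hDsize : ∀ k, c₂ * c₁ * μ.real Set.univ ≤ μ.real (D k) := fun k => by
    refine le_trans ?_ (hD k)
    rw [mul_assoc]
    exact mul_le_mul_of_nonneg_left (hC k) hc₂.le
  have hDne : ∀ k, (D k).Nonempty := fun k => by
    by_contra h
    rw [Set.not_nonempty_iff_eq_empty] at h
    have h1 := hDsize k
    rw [h, measureReal_empty] at h1
    have h2 := mul_pos (mul_pos hc₂ hc₁) hpos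
    linarith
  have hcl : ∀ a : E, a ≠ 0 → ∃ k, ∀ x ∈ D k, 0 ≤ inner ℝ a x := fun a ha => by
    obtain ⟨k, hk⟩ := hCa a ha (by
      rw [Set.univ_inter]
      exact (mul_lt_mul_of_pos_right hL hpos).trans_le (hdepth a ha))
    exact ⟨k, fun x hx => hk x (hDC k hx)⟩
  have hκ : Nonempty κ := by
    have : Nontrivial E := Module.finrank_pos_iff.1 hd
    obtain ⟨a, ha⟩ := exists_ne (0 : E)
    exact ⟨(hcl a ha).choose⟩
  choose x hx using hDne
  have h0 : (0 : E) ∈ convexHull ℝ (Set.range x) := by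
    refine zero_mem_convexHull_range_iff.2 fun a => ?_
    by_cases ha : a = 0
    · exact ⟨hκ.some, by simp [ha]⟩
    · obtain ⟨k, hk⟩ := hcl (-a) (neg_ne_zero.2 ha)
      exact ⟨k, by simpa using hk _ (hx k)⟩
  obtain ⟨n, k, hk, hind, hk0⟩ := exists_caratheodory_subfamily h0
  have hn1 : n ≤ finrank ℝ E + 1 := by
    have := hind.card_le_finrank_succ
    rw [Fintype.card_fin] at this
    exact this.trans (Nat.succ_le_succ (Submodule.finrank_le _))
  have hn2 : finrank ℝ E < n := by
    by_contra! hle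
    obtain ⟨a, ha⟩ := hsign (Finset.univ.image k) Finset.univ
      (Finset.card_image_le.trans (by simpa using hle))
    obtain ⟨i, hi⟩ := exists_inner_nonpos_of_zero_mem_convexHull hk0 a
    exact absurd ((ha (k i) (Finset.mem_image_of_mem k (Finset.mem_univ i)) _ (hx (k i))).1
      (Finset.mem_univ _)) (not_lt.2 hi)
  obtain rfl : n = finrank ℝ E + 1 := by omega
  refine ⟨fun i => D (k i), fun i => hDsize (k i), fun y hy => ?_⟩
  refine zero_mem_convexHull_of_transversal (by simp) (S := fun i => D (k i)) (fun j => ?_)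
    (fun i => hx (k i)) hy hk0
  obtain ⟨a, ha⟩ := hsign ((Finset.univ.erase j).image k) Finset.univ
    (Finset.card_image_le.trans (by simp))
  exact ⟨a, fun i hij z hz => (ha (k i) (Finset.mem_image_of_mem k
    (Finset.mem_erase.2 ⟨hij, Finset.mem_univ i⟩)) z hz).1 (Finset.mem_univ _)⟩

end Measures

/-! ### From measures to finite families of points -/

section Families

variable {E : Type*} [NormedAddCommGroup E] [InnerProductSpace ℝ E] [FiniteDimensional ℝ E]

theorem eventually_zero_notMem_convexHull {ι : Type*} [Finite ι] {x : ι → E}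
    (hx : (0 : E) ∉ convexHull ℝ (Set.range x)) :
    ∀ᶠ ε in 𝓝[>] (0 : ℝ), ∀ y : ι → E, (∀ j, dist (y j) (x j) < ε) →
      (0 : E) ∉ convexHull ℝ (Set.range y) := by
  rw [zero_mem_convexHull_range_iff] at hx
  push Not at hx
  obtain ⟨a, ha⟩ := hx
  have hδ : ∀ j, ∃ δ > 0, ∀ z, dist z (x j) < δ → 0 < inner ℝ a z := fun j =>
    Metric.eventually_nhds_iff.1
      ((isOpen_lt continuous_const (by fun_prop : Continuous fun z => inner ℝ a z)).mem_nhds (ha j))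
  choose δ hδ0 hδ using hδ
  have hev : ∀ᶠ ε in 𝓝[>] (0 : ℝ), ∀ j, ε < δ j :=
    eventually_all.2 fun j => nhdsWithin_le_nhds (Iio_mem_nhds (hδ0 j))
  filter_upwards [hev] with ε hε y hy h0
  obtain ⟨j, hj⟩ := exists_inner_nonpos_of_zero_mem_convexHull h0 a
  exact absurd (hδ j (y j) ((hy j).trans (hε j))) (not_lt.2 hj)

/-- Carathéodory's theorem in the language of half-spaces: a family of positive depth at the origin
has at most `d + 1` members whose convex hull contains the origin. -/
theorem exists_caratheodory_finset {d : ℕ} (hdim : finrank ℝ E = d) {ι : Type*} [Finite ι]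
    [Nonempty ι] (f : ι → E) (hf : ∀ a : E, a ≠ 0 → ∃ i, 0 ≤ inner ℝ a (f i)) :
    ∃ T : Finset ι, T.Nonempty ∧ T.card ≤ d + 1 ∧ (0 : E) ∈ convexHull ℝ (f '' T) := by
  classical
  have h0 : (0 : E) ∈ convexHull ℝ (Set.range f) := by
    refine zero_mem_convexHull_range_iff.2 fun a => ?_
    by_cases ha : a = 0
    · exact ⟨Classical.arbitrary ι, by simp [ha]⟩
    · obtain ⟨i, hi⟩ := hf (-a) (neg_ne_zero.2 ha)
      exact ⟨i, by simpa using hi⟩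
  obtain ⟨n, k, -, hind, hk0⟩ := exists_caratheodory_subfamily h0
  refine ⟨Finset.univ.image k, ?_, ?_, ?_⟩
  · rw [Finset.image_nonempty, Finset.univ_nonempty_iff]
    exact ⟨(exists_inner_nonpos_of_zero_mem_convexHull hk0 0).choose⟩
  · have := hind.card_le_finrank_succ
    rw [Fintype.card_fin] at this
    refine Finset.card_image_le.trans ?_
    rw [Finset.card_univ, Fintype.card_fin, ← hdim]
    exact this.trans (Nat.succ_le_succ (Submodule.finrank_le _))
  · rwa [Finset.coe_image, Finset.coe_univ, Set.image_univ, ← Set.range_comp]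

variable [MeasurableSpace E] [BorelSpace E]

/-- A half-space that contains the centre of a ball contains at least half of the ball. -/
theorem volume_ball_le_two_mul_halfspace (a c : E) (ε : ℝ) (hc : 0 ≤ inner ℝ a c) :
    volume.real (Metric.ball c ε) ≤
      2 * volume.real ({x | 0 ≤ inner ℝ a x} ∩ Metric.ball c ε) := by
  set A : Set E := {x | 0 ≤ inner ℝ a x} ∩ Metric.ball c ε with hA
  have hAm : MeasurableSet A :=
    ((isClosed_le continuous_const (by fun_prop)).measurableSet).inter measurableSet_ball
  have hfin : volume A ≠ ⊤ :=
    ((measure_mono Set.inter_subset_right).trans_lt measure_ball_lt_top).ne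
  have hpre : volume ((fun x => (c + c) - x) ⁻¹' A) = volume A :=
    (Measure.measurePreserving_sub_left volume (c + c)).measure_preimage hAm.nullMeasurableSet
  have hsub : Metric.ball c ε ⊆ A ∪ (fun x => (c + c) - x) ⁻¹' A := fun x hx => by
    rcases le_total (inner ℝ a c) (inner ℝ a x) with h | h
    · exact Or.inl ⟨hc.trans h, hx⟩
    · refine Or.inr ⟨?_, ?_⟩
      · show 0 ≤ inner ℝ a (c + c - x)
        rw [inner_sub_right, inner_add_right]
        linarith
      · rw [Metric.mem_ball, dist_eq_norm] at hx ⊢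
        rw [show c + c - x - c = -(x - c) by abel, norm_neg]
        exact hx
  have h1 : volume.real (Metric.ball c ε) ≤
      volume.real A + volume.real ((fun x => (c + c) - x) ⁻¹' A) :=
    (measureReal_mono hsub (measure_union_ne_top hfin (by rwa [hpre]))).trans
      (measureReal_union_le _ _)
  rw [measureReal_def volume (_ ⁻¹' A), hpre, ← measureReal_def] at h1
  linarith

/-- The depth Carathéodory theorem for finite families of points, with repetitions allowed and
with index sets that need not be disjoint. The points are replaced by small balls, which brings
them into general position. -/
theorem exists_depthCaratheodory_family {d : ℕ} (hdim : finrank ℝ E = d) (hd : 0 < d) {τ : ℝ}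
    (hτ : 0 < τ) :
    ∃ c : ℝ, 0 < c ∧ ∀ (ι : Type) [Fintype ι] [Nonempty ι] (f : ι → E),
      (∀ a : E, a ≠ 0 → ∃ T : Finset ι, τ * Fintype.card ι ≤ T.card ∧
        ∀ i ∈ T, 0 ≤ inner ℝ a (f i)) →
      ∃ W : Fin (d + 1) → Finset ι,
        (∀ j, c * Fintype.card ι ≤ (W j).card) ∧
        ∀ t : Fin (d + 1) → ι, (∀ j, t j ∈ W j) →
          (0 : E) ∈ convexHull ℝ (Set.range (f ∘ t)) := by
  subst hdim
  classical
  obtain ⟨c, hc, hmain⟩ := exists_depthCaratheodory_measure hd (half_pos hτ)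
  refine ⟨c, hc, fun ι _ _ f hf => ?_⟩
  -- a radius so small that no transversal can gain the origin by moving points inside the balls
  have hev : ∀ᶠ ε in 𝓝[>] (0 : ℝ), ∀ t : Fin (finrank ℝ E + 1) → ι,
      (0 : E) ∉ convexHull ℝ (Set.range (f ∘ t)) → ∀ y : Fin (finrank ℝ E + 1) → E,
        (∀ j, dist (y j) (f (t j)) < ε) → (0 : E) ∉ convexHull ℝ (Set.range y) := by
    refine eventually_all.2 fun t => ?_
    by_cases ht : (0 : E) ∈ convexHull ℝ (Set.range (f ∘ t))
    · exact Eventually.of_forall fun ε h => absurd ht h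
    · filter_upwards [eventually_zero_notMem_convexHull ht] with ε hε _ y hy using hε y hy
  obtain ⟨ε, hε, hε0⟩ := (hev.and self_mem_nhdsWithin).exists
  replace hε0 : 0 < ε := hε0
  let μ : Measure E := ∑ i, volume.restrict (Metric.ball (f i) ε)
  set v := volume.real (Metric.ball (0 : E) ε) with hv
  have hv0 : 0 < v := ENNReal.toReal_pos (Metric.measure_ball_pos volume _ hε0).ne'
    measure_ball_lt_top.ne
  have hball : ∀ i, volume.real (Metric.ball (f i) ε) = v := fun i => by
    rw [hv, measureReal_def, Measure.addHaar_ball_center, measureReal_def]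
  have hfin : ∀ (s : Set E) i, volume (s ∩ Metric.ball (f i) ε) ≠ ⊤ := fun s i =>
    ((measure_mono Set.inter_subset_right).trans_lt measure_ball_lt_top).ne
  have hμapp : ∀ s, μ s = ∑ i, volume (s ∩ Metric.ball (f i) ε) := fun s => by
    simp only [μ, Measure.finsetSum_apply, Measure.restrict_apply' measurableSet_ball]
  have hμreal : ∀ s, μ.real s = ∑ i, volume.real (s ∩ Metric.ball (f i) ε) := fun s => by
    rw [measureReal_def, hμapp, ENNReal.toReal_sum fun i _ => hfin s i]
    rfl
  have huniv : μ.real Set.univ = Fintype.card ι * v := by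
    simp [hμreal, hball]
  have : IsFiniteMeasure μ := ⟨by
    rw [hμapp]
    exact ENNReal.sum_lt_top.2 fun i _ => (hfin _ i).lt_top⟩
  have hspread : IsSpread μ := by
    refine ⟨fun a ha => ?_, (∑ i, ‖f i‖) + ε, ?_⟩
    · rw [hμapp]
      refine Finset.sum_eq_zero fun i _ => measure_mono_null Set.inter_subset_left ?_
      have hV : (ℝ ∙ a)ᗮ ≠ ⊤ := fun h => by
        have := (Submodule.mem_orthogonal_singleton_iff_inner_right).1
          (h ▸ Submodule.mem_top : a ∈ (ℝ ∙ a)ᗮ)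
        exact ha (inner_self_eq_zero.1 this)
      refine measure_mono_null (fun x hx => ?_) (Measure.addHaar_submodule volume _ hV)
      exact (Submodule.mem_orthogonal_singleton_iff_inner_right).2 hx
    · rw [hμapp]
      refine Finset.sum_eq_zero fun i _ => ?_
      have : (Metric.closedBall (0 : E) ((∑ i, ‖f i‖) + ε))ᶜ ∩ Metric.ball (f i) ε = ∅ := by
        rw [Set.eq_empty_iff_forall_notMem]
        rintro x ⟨hx, hxi⟩
        refine hx ?_
        rw [mem_closedBall_zero_iff]
        rw [mem_ball_iff_norm] at hxi
        have h1 : ‖f i‖ ≤ ∑ i, ‖f i‖ :=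
          Finset.single_le_sum (f := fun i => ‖f i‖) (fun i _ => norm_nonneg _) (Finset.mem_univ i)
        have h2 : ‖x‖ ≤ ‖x - f i‖ + ‖f i‖ := by simpa using norm_add_le (x - f i) (f i)
        linarith
      rw [this, measure_empty]
  have hcard : (0 : ℝ) < Fintype.card ι := by exact_mod_cast Fintype.card_pos
  obtain ⟨S, hS, hS0⟩ := hmain μ hspread (by rw [huniv]; positivity) fun a ha => by
    obtain ⟨T, hT, hT0⟩ := hf a ha
    rw [huniv, hμreal]
    have h1 : ∑ i ∈ T, v / 2 ≤ ∑ i, volume.real ({x | 0 ≤ inner ℝ a x} ∩ Metric.ball (f i) ε) := by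
      refine le_trans (Finset.sum_le_sum fun i hi => ?_) (Finset.sum_le_sum_of_subset_of_nonneg
        (Finset.subset_univ T) fun i _ _ => measureReal_nonneg)
      have := volume_ball_le_two_mul_halfspace a (f i) ε (hT0 i hi)
      rw [hball] at this
      linarith
    rw [Finset.sum_const, nsmul_eq_mul] at h1
    have h2 := mul_le_mul_of_nonneg_right hT (half_pos hv0).le
    linarith
  refine ⟨fun j => Finset.univ.filter fun i => (S j ∩ Metric.ball (f i) ε).Nonempty, fun j => ?_,
    fun t ht => ?_⟩
  · have h1 := hS j
    rw [huniv, hμreal] at h1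
    have h2 : ∑ i, volume.real (S j ∩ Metric.ball (f i) ε) ≤
        ∑ i, if (S j ∩ Metric.ball (f i) ε).Nonempty then v else 0 := by
      refine Finset.sum_le_sum fun i _ => ?_
      split_ifs with h
      · rw [← hball i]
        exact measureReal_mono Set.inter_subset_right measure_ball_lt_top.ne
      · rw [Set.not_nonempty_iff_eq_empty.1 h, measureReal_empty]
    rw [← Finset.sum_filter, Finset.sum_const, nsmul_eq_mul] at h2
    refine le_of_mul_le_mul_right ?_ hv0
    linarith
  · by_contra h0
    have hy : ∀ j, ∃ y, y ∈ S j ∧ dist y (f (t j)) < ε := fun j => by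
      obtain ⟨y, hy1, hy2⟩ := (Finset.mem_filter.1 (ht j)).2
      exact ⟨y, hy1, hy2⟩
    choose y hyS hyd using hy
    exact hε t h0 y hyd (hS0 y hyS)

end Families

/-! ### The depth Carathéodory theorem for finite sets -/

theorem mem_convexHull_range_of_zero_mem {d : ℕ} {ι : Type*} {x : ι → EuclideanSpace ℝ (Fin d)}
    {q : EuclideanSpace ℝ (Fin d)}
    (h : (0 : EuclideanSpace ℝ (Fin d)) ∈ convexHull ℝ (Set.range fun i => x i - q)) :
    q ∈ convexHull ℝ (Set.range x) := by
  have hsub : convexHull ℝ (Set.range fun i => x i - q) ⊆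
      (fun y => q + y) ⁻¹' convexHull ℝ (Set.range x) := by
    refine convexHull_min ?_ ((convex_convexHull ℝ _).translate_preimage_right q)
    rintro _ ⟨i, rfl⟩
    simpa using subset_convexHull ℝ (Set.range x) ⟨i, rfl⟩
  simpa using hsub h

theorem exists_finset_of_le_tukeyDepth {d : ℕ} {X : Set (EuclideanSpace ℝ (Fin d))} [Fintype X]
    {q : EuclideanSpace ℝ (Fin d)} (hX : X.Nonempty) {τ : ℝ} (h : τ ≤ tukeyDepth X q)
    {a : EuclideanSpace ℝ (Fin d)} (ha : a ≠ 0) :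
    ∃ T : Finset X, τ * Fintype.card X ≤ T.card ∧
      ∀ i ∈ T, 0 ≤ inner ℝ a ((i : EuclideanSpace ℝ (Fin d)) - q) := by
  classical
  have hcard : X.ncard = Fintype.card X := by
    rw [← Nat.card_coe_set_eq, Nat.card_eq_fintype_card]
  have hpos : (0 : ℝ) < Fintype.card X := by
    have := hX.to_subtype
    exact_mod_cast Fintype.card_pos
  refine ⟨Finset.univ.filter fun i => 0 ≤ inner ℝ a ((i : EuclideanSpace ℝ (Fin d)) - q), ?_,
    fun i hi => (Finset.mem_filter.1 hi).2⟩
  set T := Finset.univ.filter fun i : X => 0 ≤ inner ℝ a ((i : EuclideanSpace ℝ (Fin d)) - q)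
    with hT
  have hTcard : (X ∩ closedHalfspace a (inner ℝ a q)).ncard = T.card := by
    rw [← Set.ncard_coe_finset, ← Set.ncard_image_of_injective _ Subtype.val_injective]
    congr 1
    ext x
    simp [hT, closedHalfspace, inner_sub_right, and_comm]
  have hle : tukeyCount X q ≤ T.card :=
    Nat.sInf_le ⟨a, inner ℝ a q, ha, le_refl (inner ℝ a q), hTcard.symm⟩
  rw [tukeyDepth, hcard, le_div_iff₀ hpos] at h
  exact h.trans (by exact_mod_cast hle)

/-- By Hall's theorem, large subsets of a finite type can be made disjoint at the cost of a
constant factor. -/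
theorem exists_injective_selection {X : Type*} (m k : ℕ) (W : Fin m → Finset X)
    (hW : ∀ j, m * k ≤ (W j).card) :
    ∃ g : Fin m × Fin k → X, Function.Injective g ∧ ∀ p, g p ∈ W p.1 := by
  classical
  refine (Finset.all_card_le_biUnion_card_iff_exists_injective fun p : Fin m × Fin k => W p.1).1
    fun s => ?_
  rcases s.eq_empty_or_nonempty with rfl | ⟨p, hp⟩
  · simp
  · calc s.card ≤ Fintype.card (Fin m × Fin k) := Finset.card_le_univ s
      _ = m * k := by simp
      _ ≤ (W p.1).card := hW p.1
      _ ≤ _ := Finset.card_le_card fun x hx => Finset.mem_biUnion.2 ⟨p, hp, hx⟩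

/-- The depth Carathéodory theorem. If the bound on the sizes is less than one, then singletons
given by Carathéodory's theorem suffice. -/
theorem exists_depthCaratheodory {d : ℕ} (hd : 1 ≤ d) {τ : ℝ} (hτ : 0 < τ) :
    ∃ c : ℝ, 0 < c ∧ ∀ (X : Set (EuclideanSpace ℝ (Fin d))) (q : EuclideanSpace ℝ (Fin d)),
      X.Finite → d + 1 ≤ X.ncard → τ ≤ tukeyDepth X q →
      ∃ Z : Fin (d + 1) → Set (EuclideanSpace ℝ (Fin d)),
        (∀ i, Z i ⊆ X) ∧
        (∀ i j, i ≠ j → Disjoint (Z i) (Z j)) ∧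
        (∀ i, c * (X.ncard : ℝ) ≤ ((Z i).ncard : ℝ)) ∧
        ∀ x : Fin (d + 1) → EuclideanSpace ℝ (Fin d), (∀ i, x i ∈ Z i) →
          q ∈ convexHull ℝ (Set.range x) := by
  classical
  have hdim : finrank ℝ (EuclideanSpace ℝ (Fin d)) = d := by simp
  obtain ⟨c, hc, hmain⟩ := exists_depthCaratheodory_family hdim hd hτ
  refine ⟨c / (2 * (d + 1)), by positivity, fun X q hX hcardX hdepth => ?_⟩
  have hXne : X.Nonempty := Set.nonempty_of_ncard_ne_zero (by omega)
  have := hX.fintype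
  have := hXne.to_subtype
  have hcard : X.ncard = Fintype.card X := by
    rw [← Nat.card_coe_set_eq, Nat.card_eq_fintype_card]
  let f : X → EuclideanSpace ℝ (Fin d) := fun x => x - q
  have hf := fun a ha => exists_finset_of_le_tukeyDepth (q := q) hXne hdepth (a := a) ha
  -- disjoint sets of `k` points each, for any `k` that is not too large
  have hmk : ∀ k : ℕ, ∀ g : Fin (d + 1) × Fin k → X, Function.Injective g →
      c / (2 * (d + 1)) * X.ncard ≤ k →
      (∀ t : Fin (d + 1) → X, (∀ j, ∃ l, g (j, l) = t j) →
        (0 : EuclideanSpace ℝ (Fin d)) ∈ convexHull ℝ (Set.range (f ∘ t))) →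
      ∃ Z : Fin (d + 1) → Set (EuclideanSpace ℝ (Fin d)), (∀ i, Z i ⊆ X) ∧
        (∀ i j, i ≠ j → Disjoint (Z i) (Z j)) ∧
        (∀ i, c / (2 * (d + 1)) * (X.ncard : ℝ) ≤ ((Z i).ncard : ℝ)) ∧
        ∀ x : Fin (d + 1) → EuclideanSpace ℝ (Fin d), (∀ i, x i ∈ Z i) →
          q ∈ convexHull ℝ (Set.range x) := by
    intro k g hg hk hconv
    refine ⟨fun j => Set.range fun l => (g (j, l) : EuclideanSpace ℝ (Fin d)), fun i => ?_,
      fun i j hij => ?_, fun i => ?_, fun x hx => ?_⟩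
    · rintro _ ⟨l, rfl⟩
      exact (g (i, l)).2
    · rw [Set.disjoint_left]
      rintro _ ⟨l, rfl⟩ ⟨l', hl'⟩
      have := hg (Subtype.val_injective hl')
      exact hij (Prod.mk.inj this).1.symm
    · have hinj : Function.Injective fun l => (g (i, l) : EuclideanSpace ℝ (Fin d)) :=
        Subtype.val_injective.comp (hg.comp (Prod.mk_right_injective i))
      have hcardZ := Set.ncard_range_of_injective hinj
      rw [Nat.card_fin] at hcardZ
      simp only [hcardZ]
      exact hk
    · choose l hl using hx
      refine mem_convexHull_range_of_zero_mem ?_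
      have := hconv (fun j => g (j, l j)) fun j => ⟨l j, rfl⟩
      convert this using 4 with j
      simp [f, ← hl]
  have hd1 : (0 : ℝ) < d + 1 := by positivity
  by_cases hk : 1 ≤ c * X.ncard / (d + 1)
  · obtain ⟨W, hW, hW0⟩ := hmain X f hf
    set k := ⌊c * X.ncard / (d + 1)⌋₊ with hkdef
    have hk1 : 1 ≤ k := Nat.le_floor (by simpa using hk)
    have hk2 : (k : ℝ) ≤ c * X.ncard / (d + 1) := Nat.floor_le (by positivity)
    have hk3 : c * X.ncard / (d + 1) < k + 1 := Nat.lt_floor_add_one _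
    obtain ⟨g, hg, hgW⟩ := exists_injective_selection (d + 1) k W fun j => by
      have h1 := hW j
      rw [le_div_iff₀ hd1, hcard] at hk2
      have h2 : (((d + 1) * k : ℕ) : ℝ) ≤ (W j).card := by
        push_cast
        linarith
      exact_mod_cast h2
    refine hmk k g hg ?_ fun t ht => hW0 t fun j => ?_
    · have h1 : (1 : ℝ) ≤ k := by exact_mod_cast hk1
      rw [show c / (2 * (d + 1)) * (X.ncard : ℝ) = c * X.ncard / (d + 1) / 2 by field_simp]
      linarith
    · obtain ⟨l, hl⟩ := ht j
      rw [← hl]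
      exact hgW (j, l)
  · obtain ⟨T, -, hT, hT0⟩ := exists_caratheodory_finset hdim f fun a ha => by
      obtain ⟨T, hT, hT0⟩ := hf a ha
      have : 0 < T.card := by
        have h1 : (0 : ℝ) < τ * Fintype.card X := by
          have : (0 : ℝ) < Fintype.card X := by exact_mod_cast Fintype.card_pos
          positivity
        exact_mod_cast h1.trans_le hT
      obtain ⟨i, hi⟩ := Finset.card_pos.1 this
      exact ⟨i, hT0 i hi⟩
    obtain ⟨U, hTU, hU⟩ := Finset.exists_superset_card_eq hT (by rwa [← hcard])
    let e : Fin (d + 1) ≃ U := (Finset.equivFinOfCardEq hU).symm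
    refine hmk 1 (fun p => e p.1) ?_ ?_ fun t ht => ?_
    · rintro ⟨i, l⟩ ⟨j, l'⟩ h
      have := e.injective (Subtype.val_injective h)
      exact Prod.ext this (Subsingleton.elim _ _)
    · rw [show c / (2 * (d + 1)) * (X.ncard : ℝ) = c * X.ncard / (d + 1) / 2 by field_simp]
      push_cast
      linarith
    · have ht' : t = fun j => (e j : X) := by
        ext j
        obtain ⟨l, hl⟩ := ht j
        rw [← hl]
      refine convexHull_mono ?_ hT0
      rintro _ ⟨i, hi, rfl⟩
      exact ⟨e.symm ⟨i, hTU hi⟩, by simp [ht']⟩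

/-! ### Separation and signed lifting -/

theorem ncard_union_le_card_sum {α : Type*} (R B : Set α) [Fintype R] [Fintype B] :
    (R ∪ B).ncard ≤ Fintype.card (R ⊕ B) := by
  have h := Set.ncard_union_le R B
  rwa [← Nat.card_coe_set_eq R, ← Nat.card_coe_set_eq B, Nat.card_eq_fintype_card,
    Nat.card_eq_fintype_card, ← Fintype.card_sum] at h

theorem nonempty_sum_of_nonempty_union {α : Type*} {R B : Set α} (hne : (R ∪ B).Nonempty) :
    Nonempty (R ⊕ B) := by
  obtain ⟨x, hx | hx⟩ := hne
  · exact ⟨Sum.inl ⟨x, hx⟩⟩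
  · exact ⟨Sum.inr ⟨x, hx⟩⟩

section Kirchberger

variable {d : ℕ}

/-- The lift of `x` to the affine hyperplane of points of `ℝ^(d+1)` with first coordinate `1`. -/
noncomputable def affineLift (x : EuclideanSpace ℝ (Fin d)) : EuclideanSpace ℝ (Fin (d + 1)) :=
  WithLp.toLp 2 (Fin.cons 1 (fun i => x i))

theorem inner_affineLift (b : ℝ) (a x : EuclideanSpace ℝ (Fin d)) :
    inner ℝ (WithLp.toLp 2 (Fin.cons b (fun i => a i)) : EuclideanSpace ℝ (Fin (d + 1)))
      (affineLift x) = b + inner ℝ a x := by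
  simp [affineLift, PiLp.inner_apply, Fin.sum_univ_succ]

/-- Kirchberger's lifting: points of `R` are lifted, points of `B` are lifted and reflected in the
origin. A point of `R ∩ B` gives rise to two vectors. -/
noncomputable def signedLift (R B : Set (EuclideanSpace ℝ (Fin d))) :
    R ⊕ B → EuclideanSpace ℝ (Fin (d + 1)) :=
  Sum.elim (fun x => affineLift x) (fun x => -affineLift x)

/-- A strict linear separation of the lifts gives a separating hyperplane, also if the linear
functional is constant on the lifts; then one of the sets is empty. -/
theorem separatedByHyperplane_of_affineLift (hd : 1 ≤ d) {A B : Set (EuclideanSpace ℝ (Fin d))}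
    (hA : A.Finite) (hB : B.Finite) {a : EuclideanSpace ℝ (Fin (d + 1))}
    (hAa : ∀ x ∈ A, inner ℝ a (affineLift x) < 0) (hBa : ∀ x ∈ B, 0 < inner ℝ a (affineLift x)) :
    SeparatedByHyperplane A B := by
  set a' : EuclideanSpace ℝ (Fin d) := WithLp.toLp 2 (fun i => a i.succ) with ha'
  have haa : a = WithLp.toLp 2 (Fin.cons (a 0) (fun i => a' i)) := by
    ext i
    refine Fin.cases ?_ (fun i => ?_) i <;> simp [ha']
  have hinner : ∀ x, inner ℝ a (affineLift x) = a 0 + inner ℝ a' x := fun x => by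
    conv_lhs => rw [haa]
    rw [inner_affineLift]
  simp only [hinner] at hAa hBa
  by_cases h0 : a' = 0
  · simp only [h0, inner_zero_left, add_zero] at hAa hBa
    obtain ⟨e, he⟩ : ∃ e : EuclideanSpace ℝ (Fin d), e ≠ 0 := by
      have : Nontrivial (EuclideanSpace ℝ (Fin d)) :=
        Module.finrank_pos_iff (R := ℝ).1 (by rw [finrank_euclideanSpace_fin]; exact hd)
      exact exists_ne 0
    rcases A.eq_empty_or_nonempty with rfl | ⟨x, hx⟩
    · obtain ⟨b, hb⟩ := (hB.image fun x => inner ℝ e x).bddBelow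
      refine ⟨e, b - 1, he, fun x hx => absurd hx (Set.notMem_empty x), fun x hx => ?_⟩
      have := hb (Set.mem_image_of_mem _ hx)
      linarith
    · obtain ⟨b, hb⟩ := (hA.image fun x => inner ℝ e x).bddAbove
      refine ⟨e, b + 1, he, fun y hy => ?_, fun y hy => absurd (hBa y hy) (hAa x hx).not_gt⟩
      have := hb (Set.mem_image_of_mem _ hy)
      linarith
  · refine ⟨a', -a 0, h0, fun x hx => ?_, fun x hx => ?_⟩
    · linarith [hAa x hx]
    · linarith [hBa x hx]

/-- If a choice of signed lifts captures the origin, then the coloured points underneath cannot be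
separated. -/
theorem not_separatedByHyperplane_of_zero_mem {R B : Set (EuclideanSpace ℝ (Fin d))} {κ : Type*}
    {t : κ → R ⊕ B}
    (h : (0 : EuclideanSpace ℝ (Fin (d + 1))) ∈ convexHull ℝ (Set.range (signedLift R B ∘ t)))
    {S : Set (EuclideanSpace ℝ (Fin d))}
    (hS : ∀ j, Sum.elim Subtype.val Subtype.val (t j) ∈ S) :
    ¬ SeparatedByHyperplane (S ∩ R) (S ∩ B) := by
  rintro ⟨a, b, -, hR, hB⟩
  obtain ⟨j, hj⟩ := exists_inner_nonpos_of_zero_mem_convexHull h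
    (-(WithLp.toLp 2 (Fin.cons (-b) (fun i => a i))))
  have hSj := hS j
  rcases htj : t j with x | x
  · rw [htj] at hSj
    have := hR x ⟨hSj, x.2⟩
    simp only [Function.comp_apply, htj, signedLift, Sum.elim_inl, inner_neg_left,
      inner_affineLift] at hj
    linarith
  · rw [htj] at hSj
    have := hB x ⟨hSj, x.2⟩
    simp only [Function.comp_apply, htj, signedLift, Sum.elim_inr, inner_neg_left,
      inner_neg_right, inner_affineLift] at hj
    linarith

/-- If no `β n` points can be separated, then the origin has depth larger than `1 - β` in the
family of signed lifts. -/
theorem exists_finset_signedLift (hd : 1 ≤ d) {R B : Set (EuclideanSpace ℝ (Fin d))}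
    [Fintype R] [Fintype B] {β : ℝ} (hβ : 0 ≤ β)
    (hsep : ∀ R' B' : Set (EuclideanSpace ℝ (Fin d)), R' ⊆ R → B' ⊆ B →
      SeparatedByHyperplane R' B' → ((R' ∪ B').ncard : ℝ) < β * (R ∪ B).ncard)
    (a : EuclideanSpace ℝ (Fin (d + 1))) :
    ∃ T : Finset (R ⊕ B), (1 - β) * Fintype.card (R ⊕ B) < T.card ∧
      ∀ i ∈ T, 0 ≤ inner ℝ a (signedLift R B i) := by
  classical
  refine ⟨Finset.univ.filter fun i => 0 ≤ inner ℝ a (signedLift R B i), ?_,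
    fun i hi => (Finset.mem_filter.1 hi).2⟩
  set T := Finset.univ.filter fun i => 0 ≤ inner ℝ a (signedLift R B i) with hT
  let R' : Set (EuclideanSpace ℝ (Fin d)) := {x | x ∈ R ∧ inner ℝ a (affineLift x) < 0}
  let B' : Set (EuclideanSpace ℝ (Fin d)) := {x | x ∈ B ∧ 0 < inner ℝ a (affineLift x)}
  have hR' : R' ⊆ R := fun x hx => hx.1
  have hB' : B' ⊆ B := fun x hx => hx.1
  have hR'fin : R'.Finite := R.toFinite.subset hR'
  have hB'fin : B'.Finite := B.toFinite.subset hB'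
  have hlt := hsep R' B' hR' hB' (separatedByHyperplane_of_affineLift hd hR'fin hB'fin
    (fun x hx => hx.2) (fun x hx => hx.2))
  have hl : ∀ x : R, Sum.inl x ∈ (↑Tᶜ : Set (R ⊕ B)) →
      inner ℝ a (affineLift (x : EuclideanSpace ℝ (Fin d))) < 0 := fun x hx => by
    rw [Finset.mem_coe, Finset.mem_compl, hT, Finset.mem_filter] at hx
    simpa [signedLift] using hx
  have hr : ∀ x : B, Sum.inr x ∈ (↑Tᶜ : Set (R ⊕ B)) →
      0 < inner ℝ a (affineLift (x : EuclideanSpace ℝ (Fin d))) := fun x hx => by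
    rw [Finset.mem_coe, Finset.mem_compl, hT, Finset.mem_filter] at hx
    simpa [signedLift] using hx
  have hTc : Tᶜ.card ≤ (R' ∪ B').ncard := by
    rw [← Set.ncard_coe_finset]
    refine Set.ncard_le_ncard_of_injOn (Sum.elim Subtype.val Subtype.val) ?_ ?_
      (hR'fin.union hB'fin)
    · rintro (x | x) hx
      · exact Or.inl ⟨x.2, hl x hx⟩
      · exact Or.inr ⟨x.2, hr x hx⟩
    · rintro (x | x) hx (y | y) hy hxy
      · exact congrArg Sum.inl (Subtype.ext hxy)
      · have h := hr y hy
        rw [← show (x : EuclideanSpace ℝ (Fin d)) = y from hxy] at h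
        exact absurd (hl x hx) h.not_gt
      · have h := hl y hy
        rw [← show (x : EuclideanSpace ℝ (Fin d)) = y from hxy] at h
        exact absurd (hr x hx) h.not_gt
      · exact congrArg Sum.inr (Subtype.ext hxy)
  have hn : ((R ∪ B).ncard : ℝ) ≤ Fintype.card (R ⊕ B) := by
    exact_mod_cast ncard_union_le_card_sum R B
  have hsum : (T.card : ℝ) + Tᶜ.card = Fintype.card (R ⊕ B) := by
    exact_mod_cast Finset.card_add_card_compl T
  have hTc' : (Tᶜ.card : ℝ) ≤ (R' ∪ B').ncard := by exact_mod_cast hTc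
  have := mul_le_mul_of_nonneg_left hn hβ
  linarith

/-- Positive depth of the signed lifts produces `d + 2` large sets of coloured points, no
transversal of which can be separated. -/
theorem exists_large_inseparable {τ : ℝ} (hτ : 0 < τ) :
    ∃ c : ℝ, 0 < c ∧ ∀ (R B : Set (EuclideanSpace ℝ (Fin d))) [Fintype R] [Fintype B],
      (R ∪ B).Nonempty →
      (∀ a, ∃ T : Finset (R ⊕ B), τ * Fintype.card (R ⊕ B) < T.card ∧
        ∀ i ∈ T, 0 ≤ inner ℝ a (signedLift R B i)) →
      ∃ Y : Fin (d + 2) → Set (EuclideanSpace ℝ (Fin d)),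
        (∀ i, Y i ⊆ R ∪ B ∧ (Y i).Nonempty ∧ c * ((R ∪ B).ncard : ℝ) ≤ ((Y i).ncard : ℝ)) ∧
        ∀ y : Fin (d + 2) → EuclideanSpace ℝ (Fin d), (∀ i, y i ∈ Y i) →
          ¬ SeparatedByHyperplane (Set.range y ∩ R) (Set.range y ∩ B) := by
  classical
  have hdim : finrank ℝ (EuclideanSpace ℝ (Fin (d + 1))) = d + 1 := by simp
  obtain ⟨c, hc, hmain⟩ := exists_depthCaratheodory_family hdim (Nat.succ_pos d) hτ
  refine ⟨c / 2, half_pos hc, fun R B _ _ hne hf => ?_⟩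
  have := nonempty_sum_of_nonempty_union hne
  obtain ⟨W, hW, hW0⟩ := hmain (R ⊕ B) (signedLift R B) fun a _ =>
    (hf a).imp fun T hT => ⟨hT.1.le, hT.2⟩
  let π : R ⊕ B → EuclideanSpace ℝ (Fin d) := Sum.elim Subtype.val Subtype.val
  have hn0 : 0 < (R ∪ B).ncard :=
    (Set.ncard_pos (R.toFinite.union B.toFinite)).2 hne
  have hn : ((R ∪ B).ncard : ℝ) ≤ Fintype.card (R ⊕ B) := by
    exact_mod_cast ncard_union_le_card_sum R B
  -- a point below may come from two lifts, whence the factor two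
  have hcard : ∀ j, (W j).card ≤ 2 * (π '' (W j : Set (R ⊕ B))).ncard := fun j => by
    have hfin : (π '' (W j : Set (R ⊕ B))).Finite := (W j).finite_toSet.image π
    have h1 : (W j).toLeft.card ≤ (π '' (W j : Set (R ⊕ B))).ncard := by
      rw [← Set.ncard_coe_finset]
      refine Set.ncard_le_ncard_of_injOn Subtype.val (fun x hx => ?_)
        Subtype.val_injective.injOn hfin
      exact ⟨Sum.inl x, by simpa using hx, rfl⟩
    have h2 : (W j).toRight.card ≤ (π '' (W j : Set (R ⊕ B))).ncard := by
      rw [← Set.ncard_coe_finset]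
      refine Set.ncard_le_ncard_of_injOn Subtype.val (fun x hx => ?_)
        Subtype.val_injective.injOn hfin
      exact ⟨Sum.inr x, by simpa using hx, rfl⟩
    have h3 := Finset.card_toLeft_add_card_toRight (u := W j)
    omega
  have hsize : ∀ j, c / 2 * ((R ∪ B).ncard : ℝ) ≤ ((π '' (W j : Set (R ⊕ B))).ncard : ℝ) :=
    fun j => by
      have h1 : ((W j).card : ℝ) ≤ 2 * ((π '' (W j : Set (R ⊕ B))).ncard : ℝ) := by
        exact_mod_cast hcard j
      have h2 := mul_le_mul_of_nonneg_left hn hc.le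
      linarith [hW j]
  refine ⟨fun j => π '' (W j : Set (R ⊕ B)), fun j => ⟨?_, ?_, hsize j⟩, fun y hy => ?_⟩
  · rintro _ ⟨x | x, -, rfl⟩
    · exact Or.inl x.2
    · exact Or.inr x.2
  · refine Set.nonempty_of_ncard_ne_zero fun h0 => ?_
    have h1 := hsize j
    rw [h0] at h1
    have h2 : (0 : ℝ) < (R ∪ B).ncard := by exact_mod_cast hn0
    have h3 := mul_pos (half_pos hc) h2
    simp only [Nat.cast_zero] at h1
    linarith
  · choose t ht hty using hy
    exact not_separatedByHyperplane_of_zero_mem (hW0 t fun j => ht j) fun j => ⟨j, (hty j).symm⟩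

/-- Kirchberger's theorem in contrapositive form. -/
theorem exists_inseparable_tuple {R B : Set (EuclideanSpace ℝ (Fin d))} [Fintype R] [Fintype B]
    (hne : (R ∪ B).Nonempty) (hf : ∀ a, ∃ i, 0 ≤ inner ℝ a (signedLift R B i)) :
    ∃ y : Fin (d + 2) → EuclideanSpace ℝ (Fin d), (∀ i, y i ∈ R ∪ B) ∧
      ¬ SeparatedByHyperplane (Set.range y ∩ R) (Set.range y ∩ B) := by
  have hdim : finrank ℝ (EuclideanSpace ℝ (Fin (d + 1))) = d + 1 := by simp
  have := nonempty_sum_of_nonempty_union hne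
  obtain ⟨T, hTne, hT, hT0⟩ := exists_caratheodory_finset hdim (signedLift R B) fun a _ => hf a
  have := hTne.to_subtype
  obtain ⟨e⟩ : Nonempty (T ↪ Fin (d + 2)) :=
    Function.Embedding.nonempty_of_card_le (by simpa using hT)
  let s : Fin (d + 2) → T := Function.invFun e
  have hs : Function.Surjective s := Function.invFun_surjective e.injective
  let y : Fin (d + 2) → EuclideanSpace ℝ (Fin d) :=
    fun j => Sum.elim Subtype.val Subtype.val (s j : R ⊕ B)
  refine ⟨y, fun j => ?_, ?_⟩
  · rcases h : (s j : R ⊕ B) with x | x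
    · exact Or.inl (by simp [y, h])
    · exact Or.inr (by simp [y, h])
  · refine not_separatedByHyperplane_of_zero_mem (t := fun j => (s j : R ⊕ B))
      (convexHull_mono ?_ hT0) fun j => ⟨j, rfl⟩
    rintro _ ⟨i, hi, rfl⟩
    obtain ⟨j, hj⟩ := hs ⟨i, hi⟩
    exact ⟨j, by simp [hj]⟩

end Kirchberger

/-! ### The depth versions of Carathéodory's and Kirchberger's theorems -/

theorem mainTheorem6 :
    ∃ c : ℕ → ℝ → ℝ, IsDepthCaratheodoryConstant c ∧ (∀ d : ℕ, c d 0 = 0) ∧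
      ∀ (d : ℕ) (β α : ℝ), 2 ≤ d → 0 ≤ β → β ≤ 1 → α = c d (1 - β) →
      ∀ (R B : Set (EuclideanSpace ℝ (Fin d))) (n : ℕ), (R ∪ B).Finite → (R ∪ B).ncard = n →
        (∀ Y : Fin (d + 2) → Set (EuclideanSpace ℝ (Fin d)),
          (∀ i, Y i ⊆ R ∪ B ∧ (Y i).Nonempty ∧ α * (n : ℝ) ≤ ((Y i).ncard : ℝ)) →
          ∃ y : Fin (d + 2) → EuclideanSpace ℝ (Fin d), (∀ i, y i ∈ Y i) ∧
            SeparatedByHyperplane (Set.range y ∩ R) (Set.range y ∩ B)) →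
        ∃ R' B' : Set (EuclideanSpace ℝ (Fin d)), R' ⊆ R ∧ B' ⊆ B ∧
          β * (n : ℝ) ≤ ((R' ∪ B').ncard : ℝ) ∧ SeparatedByHyperplane R' B' := by
  classical
  choose c₁ hc₁ h₁ using @exists_depthCaratheodory
  choose c₂ hc₂ h₂ using @exists_large_inseparable
  -- the same constant has to serve for sets in dimension `d` and for signed lifts in dimension
  -- `d + 1`
  let c : ℕ → ℝ → ℝ := fun d τ =>
    if h : 1 ≤ d ∧ 0 < τ then min (c₁ h.1 h.2) (c₂ (d := d) h.2) else 0
  have hcpos : ∀ {d τ} (hd : 1 ≤ d) (hτ : 0 < τ), c d τ = min (c₁ hd hτ) (c₂ (d := d) hτ) :=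
    fun hd hτ => dif_pos ⟨hd, hτ⟩
  refine ⟨c, ⟨fun d hd τ hτ => ?_, fun d hd X q hX hcard hτ => ?_⟩, fun d => ?_, ?_⟩
  · rw [hcpos hd hτ]
    exact lt_min (hc₁ hd hτ) (hc₂ hτ)
  · obtain ⟨Z, hZX, hdisj, hZ, hconv⟩ := h₁ hd hτ X q hX hcard le_rfl
    refine ⟨Z, hZX, hdisj, fun i => le_trans ?_ (hZ i), hconv⟩
    rw [hcpos hd hτ]
    exact mul_le_mul_of_nonneg_right (min_le_left _ _) (Nat.cast_nonneg _)
  · exact dif_neg fun h => lt_irrefl _ h.2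
  · rintro d β α hd hβ0 hβ1 rfl R B n hfin rfl hY
    by_contra! hcon
    have hsep : ∀ R' B' : Set (EuclideanSpace ℝ (Fin d)), R' ⊆ R → B' ⊆ B →
        SeparatedByHyperplane R' B' → ((R' ∪ B').ncard : ℝ) < β * (R ∪ B).ncard :=
      fun R' B' hR' hB' hs => not_le.1 fun hle => hcon R' B' hR' hB' hle hs
    have := (hfin.subset Set.subset_union_left).fintype
    have := (hfin.subset Set.subset_union_right).fintype
    have hd1 : 1 ≤ d := by omega
    have hdepth := exists_finset_signedLift hd1 hβ0 hsep
    have hne : (R ∪ B).Nonempty := by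
      obtain ⟨T, hT, -⟩ := hdepth 0
      have hT0 : 0 < T.card := by
        have h : (0 : ℝ) ≤ (1 - β) * Fintype.card (R ⊕ B) :=
          mul_nonneg (by linarith) (Nat.cast_nonneg _)
        exact_mod_cast h.trans_lt hT
      obtain ⟨x | x, -⟩ := Finset.card_pos.1 hT0
      · exact ⟨x, Or.inl x.2⟩
      · exact ⟨x, Or.inr x.2⟩
    rcases hβ1.lt_or_eq with hβ | rfl
    · have hτ : 0 < 1 - β := by linarith
      obtain ⟨Y, hYp, hYs⟩ := h₂ hτ R B hne hdepth
      obtain ⟨y, hy, hys⟩ := hY Y fun i => ⟨(hYp i).1, (hYp i).2.1, by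
        refine le_trans ?_ (hYp i).2.2
        rw [hcpos hd1 hτ]
        exact mul_le_mul_of_nonneg_right (min_le_right _ _) (Nat.cast_nonneg _)⟩
      exact hYs y hy hys
    · obtain ⟨y, hy, hys⟩ := exists_inseparable_tuple hne fun a => by
        obtain ⟨T, hT, hT0⟩ := hdepth a
        rw [sub_self, zero_mul] at hT
        obtain ⟨i, hi⟩ := Finset.card_pos.1 (by exact_mod_cast hT : 0 < T.card)
        exact ⟨i, hT0 i hi⟩
      -- for `β = 1` the threshold is `0`, so that singletons are allowed
      have hc0 : c d (1 - 1) = 0 := dif_neg fun h => by simp at h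
      obtain ⟨z, hz, hzs⟩ := hY (fun i => {y i}) fun i => ⟨by simpa using hy i, by simp, by
        rw [hc0, zero_mul]
        exact Nat.cast_nonneg _⟩
      obtain rfl : z = y := funext fun i => by simpa using hz i
      exact hys hzs
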